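/- Let $P$ be a finite ordered set with exactly two maximal elements $p_0 \neq p_1$. For a finite lattice $L$, let $\operatorname{Con} L$ be the lattice of congruences of $L$ ordered by inclusion, with zero $\mathbf 0$ (equality) and unit $\mathbf 1$ (all pairs). For $x,y\in L$ let $\operatorname{con}(x,y)$ be the smallest congruence of $L$ identifying $x$ and $y$; the congruences of this form are the principal ones. Let $\operatorname{Ji}(\operatorname{Con} L)$ be the ordered set of (nonzero) join-irreducible congruences. Write $x\prec y$ if $y$ covers $x$. Then there are a finite lattice $L$ with zero $o$ and unit $o'$, an element $i\in L$ distinct from $o$ and $o'$, an order isomorphism $\zeta\colon P\to \operatorname{Ji}(\operatorname{Con} L)$, elements $a_p, b_p\in L$ for each $p<p_0$, and elements $a'_p, b'_p\in L$ for each $p<p_1$, such that the following nine statements hold. (i) Every principal congruence of $L$ other than $\mathbf 0$ and $\mathbf 1$ is join-irreducible. (ii) $\operatorname{con}(x,i)=\zeta(p_0)$ for all $x\in L$ with $x<i$. (iii) $\operatorname{con}(x,i)=\zeta(p_1)$ for all $x\in L$ with $x>i$. (iv) For each $p\in P$ with $p<p_0$: $a_p\prec b_p\prec i$ and $\operatorname{con}(a_p,b_p)=\zeta(p)$.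 (v) For each $p\in P$ with $p<p_1$: $i\prec b'_p\prec a'_p$ and $\operatorname{con}(a'_p,b'_p)=\zeta(p)$. (vi) For each $p\in P$ with $p\nleq p_1$ and $p\neq p_0$, the elements $a_p$ and $b_p$ are meet-irreducible in $L$. (vii) For each $p\in P$ with $p\nleq p_0$ and $p\neq p_1$, the elements $a'_p$ and $b'_p$ are join-irreducible in $L$. (viii) For each $p\in P$ with $p<p_0$ and each $x\in L$ with $x\neq a_p$ and $x<b_p$: $\operatorname{con}(x,b_p)=\zeta(p_0)$. (ix) For each $p\in P$ with $p<p_1$ and each $x\in L$ with $x\neq a'_p$ and $x>b'_p$: $\operatorname{con}(x,b'_p)=\zeta(p_1)$. -/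

import Mathlib

universe u

namespace LatticeCon

variable {L : Type u} [Lattice L]

theorem rel_injective : Function.Injective fun α : LatticeCon L => α.r := by
  rintro ⟨⟨r, _⟩, _, _⟩ ⟨⟨s, _⟩, _, _⟩ h
  obtain rfl : r = s := h
  rfl

/-- Congruences are ordered by inclusion: `α ≤ β` iff `x ≡ y (α)` implies `x ≡ y (β)`. -/
instance : PartialOrder (LatticeCon L) where
  le α β := ∀ x y, α.r x y → β.r x y
  le_refl _ _ _ h := h
  le_trans _ _ _ h₁ h₂ x y h := h₂ x y (h₁ x y h)
  le_antisymm α β h₁ h₂ :=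
    rel_injective (funext fun x => funext fun y => propext ⟨h₁ x y, h₂ x y⟩)

/-- The intersection of a set of congruences. -/
instance : InfSet (LatticeCon L) where
  sInf S :=
    { r := fun x y => ∀ α ∈ S, α.r x y
      iseqv :=
        { refl := fun x α _ => α.refl x
          symm := fun h α hα => α.symm (h α hα)
          trans := fun h₁ h₂ α hα => α.trans (h₁ α hα) (h₂ α hα) }
      inf := fun h₁ h₂ α hα => α.inf (h₁ α hα) (h₂ α hα)
      sup := fun h₁ h₂ α hα => α.sup (h₁ α hα) (h₂ α hα) }

/-- The congruence lattice `Con L`: `⊥` is equality and `⊤` relates any two elements. -/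
instance : CompleteLattice (LatticeCon L) :=
  completeLatticeOfInf (LatticeCon L) fun _ =>
    ⟨fun α hα _ _ h => h α hα, fun _ hβ x y h _ hα => hβ hα x y h⟩

/-- `con x y` is the smallest congruence that identifies `x` and `y`. -/
def con (x y : L) : LatticeCon L := sInf {α | α.r x y}

end LatticeCon

/-- `Princ L`: the set of principal congruences of `L`. -/
def Princ (L : Type u) [Lattice L] : Set (LatticeCon L) :=
  {α | ∃ x y : L, α = LatticeCon.con x y}

/-- `Ji D`: the ordered set of the join-irreducible elements of a lattice `D`
(the zero is not counted as join-irreducible). -/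
abbrev Ji (D : Type u) [Lattice D] : Type u := {d : D // SupIrred d}

/-!
The lattice is built explicitly and studied through its order alone.

*One wing.* Over an ordered set `Q` the wing `Half Q`, with a unit added on top, has an edge
`side p false ⋖ side p true` of color `p` for each `p`, just below the unit. For `p < q` there is a
chain `f < f' < g` of three elements (the elements `gad p q`). Its top `g` lies below the upper ends
of the edges of colors `p` and `q`; it meets the lower end of the edge of color `q` in `f` and the
lower end of the edge of color `p` in `f'`. So collapsing the edge of color `q` collapses `[f, g]`,
hence `[f', g]` and with it the edge of color `p`, while collapsing the edge of color `p` collapses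
only `[f', g]`. Three extra atoms, each a complement of every other element strictly between zero
and unit, make every interval outside these edges and chains generate the collapse of the whole
wing.

*Gluing.* `Glued p₀ p₁` puts the wing over the elements below `p₀` under a central element `ctr` and
the dual of the wing over the elements below `p₁` above it. For an element `p` below both, a
five-element diamond above the lower edge and below the upper edge of color `p` makes the two edges
generate the same congruence. The construction is symmetric: exchanging `p₀` and `p₁` dualizes the
lattice (`Glued.swap`), so every argument about the lower wing serves for the upper one.

*Congruences.* A congruence is determined by the set of colors it collapses, which is a lower set of
`P` (`Glued.Collapses.of_le`), because every interval is collapsed together with nothing, with the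
edges of a single color, or with everything (`Glued.hasColor_of_le`). Conversely every lower set
arises (`Glued.exists_collapses_iff`); the required congruences are given by the maps that send an
element to the ends of its class, and `LatticeCon.ofClosure` reduces compatibility to monotonicity
of these maps. So the congruence lattice is the lattice of lower sets of `P` (`Glued.conIso`), its
join-irreducible elements are the principal lower sets, and the intervals that generate everything
account for the unit.
-/

/-! ### Lattices and congruences through the order alone -/

/-- A finite partial order with a least element in which any two elements that have an upper bound
have a least one has all binary meets. -/
theorem exists_isGLB_of_bounded_lub {α : Type*} [PartialOrder α] [OrderBot α] [Finite α]
    (h : ∀ x y z : α, x ≤ z → y ≤ z → ∃ w, IsLUB {x, y} w) (x y : α) : ∃ w, IsGLB {x, y} w := by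
  obtain ⟨m, hm⟩ := (lowerBounds {x, y} : Set α).toFinite.exists_maximal ⟨⊥, by simp [lowerBounds]⟩
  refine ⟨m, hm.prop, fun w hw => ?_⟩
  obtain ⟨l, hl⟩ := h m w x (hm.prop (by simp)) (hw (by simp))
  have hlx : l ∈ lowerBounds {x, y} := by
    intro t ht
    refine hl.2 ?_
    rintro s (rfl | rfl)
    exacts [hm.prop ht, hw ht]
  exact (hl.1 (by simp : w ∈ ({m, w} : Set α))).trans (hm.le_of_ge hlx (hl.1 (by simp)))

/-- The lattice structure of a finite partial order with a least element and binary joins. -/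
noncomputable abbrev latticeOfExistsLUB (α : Type*) [PartialOrder α] [OrderBot α] [Finite α]
    (h : ∀ x y : α, ∃ w, IsLUB {x, y} w) : Lattice α :=
  have hg := exists_isGLB_of_bounded_lub fun x y (_ : α) _ _ => h x y
  { (inferInstance : PartialOrder α) with
    sup := fun x y => (h x y).choose
    le_sup_left := fun x y => (h x y).choose_spec.1 (by simp)
    le_sup_right := fun x y => (h x y).choose_spec.1 (by simp)
    sup_le := fun x y z hx hy => (h x y).choose_spec.2 (by simp [upperBounds, hx, hy])
    inf := fun x y => (hg x y).choose
    inf_le_left := fun x y => (hg x y).choose_spec.1 (by simp)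
    inf_le_right := fun x y => (hg x y).choose_spec.1 (by simp)
    le_inf := fun x y z hx hy => (hg y z).choose_spec.2 (by simp [lowerBounds, hx, hy]) }

theorem isLUB_pair_of {α : Type*} [PartialOrder α] {x y z : α} (hx : x ≤ z) (hy : y ≤ z)
    (h : ∀ w, x ≤ w → y ≤ w → z ≤ w) : IsLUB {x, y} z :=
  ⟨by simp [upperBounds, hx, hy], fun w hw => h w (hw (by simp)) (hw (by simp))⟩

theorem supIrred_apply_iff {α β : Type*} [SemilatticeSup α] [SemilatticeSup β] (e : α ≃o β)
    {a : α} :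
    SupIrred (e a) ↔ SupIrred a := by
  simp only [SupIrred, e.isMin_apply]
  refine and_congr_right fun _ => ⟨fun h b c hbc => ?_, fun h b c hbc => ?_⟩
  · simpa using @h (e b) (e c) (by rw [← map_sup, hbc])
  · have := @h (e.symm b) (e.symm c) (by rw [← map_sup, hbc, e.symm_apply_apply])
    simpa [e.symm_apply_eq] using this

namespace LatticeCon

variable {L : Type u} [Lattice L]

/-- A congruence that collapses `x ≤ y` collapses every interval `u ≤ v` with `x ≤ u` and
`v ≤ u ⊔ y`. -/
theorem rel_up (α : LatticeCon L) {x y u v : L} (h : α.r x y) (hxu : x ≤ u) (huv : u ≤ v)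
    (hv : ∀ w, u ≤ w → y ≤ w → v ≤ w) : α.r u v := by
  have h1 := α.inf (α.sup (α.refl u) h) (α.refl v)
  have h2 : v ≤ u ⊔ y := hv _ le_sup_left le_sup_right
  rwa [sup_eq_left.2 hxu, inf_eq_left.2 huv, inf_eq_right.2 h2] at h1

/-- A congruence that collapses `x ≤ y` collapses every interval `u ≤ v` with `v ≤ y` and
`v ⊓ x ≤ u`. -/
theorem rel_down (α : LatticeCon L) {x y u v : L} (h : α.r x y) (hvy : v ≤ y) (huv : u ≤ v)
    (hu : ∀ w, w ≤ v → w ≤ x → w ≤ u) : α.r u v := by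
  have h1 := α.sup (α.inf h (α.refl v)) (α.refl u)
  have h2 : x ⊓ v ≤ u := hu _ inf_le_right inf_le_left
  rwa [sup_eq_right.2 h2, inf_eq_right.2 hvy, sup_eq_left.2 huv] at h1

theorem rel_of_le (α : LatticeCon L) {x y u v : L} (h : α.r x y) (hxu : x ≤ u) (huv : u ≤ v)
    (hvy : v ≤ y) : α.r u v :=
  α.rel_up h hxu huv fun _ _ hy => hvy.trans hy

theorem con_rel (x y : L) : (con x y).r x y := fun _ h => h

theorem con_le_iff {x y : L} {α : LatticeCon L} : con x y ≤ α ↔ α.r x y :=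
  ⟨fun h => h _ _ (con_rel x y), fun h _ _ hab => hab α h⟩

/-- Two monotone maps `S ≤ id ≤ T` with `T ∘ S = T` and `S ∘ T = S` describe a congruence whose
classes are the intervals from `S x` to `T x`. -/
def ofClosure (T S : L → L) (hT : Monotone T) (hS : Monotone S) (hxT : ∀ x, x ≤ T x)
    (hSx : ∀ x, S x ≤ x) (hTS : ∀ x, T (S x) = T x) (hST : ∀ x, S (T x) = S x) :
    LatticeCon L where
  r x y := T x = T y
  iseqv := ⟨fun _ => rfl, fun h => h.symm, fun h h' => h.trans h'⟩
  sup := by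
    have hTT : ∀ x, T (T x) = T x := fun x => by rw [← hTS (T x), hST, hTS]
    have key : ∀ {w x y z}, T w = T x → T y = T z → T (w ⊔ y) ≤ T (x ⊔ z) := by
      intro w x y z h1 h2
      rw [← hTT (x ⊔ z)]
      refine hT (sup_le ?_ ?_)
      · exact (hxT w).trans (h1.le.trans (hT le_sup_left))
      · exact (hxT y).trans (h2.le.trans (hT le_sup_right))
    intro w x y z h1 h2
    exact le_antisymm (key h1 h2) (key h1.symm h2.symm)
  inf := by
    have hSS : ∀ x, S (S x) = S x := fun x => by rw [← hST (S x), hTS, hST]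
    have hSe : ∀ {x y}, T x = T y → S x = S y := fun {x y} h => by rw [← hST x, h, hST]
    have key : ∀ {w x y z}, T w = T x → T y = T z → S (w ⊓ y) ≤ S (x ⊓ z) := by
      intro w x y z h1 h2
      rw [← hSS (w ⊓ y)]
      refine hS (le_inf ?_ ?_)
      · exact (hS inf_le_left).trans ((hSe h1).le.trans (hSx x))
      · exact (hS inf_le_right).trans ((hSe h2).le.trans (hSx z))
    intro w x y z h1 h2
    rw [← hTS (w ⊓ y), ← hTS (x ⊓ z), le_antisymm (key h1 h2) (key h1.symm h2.symm)]

/-- The pullback of a congruence along an antiisomorphism. -/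
def comapDual {M : Type u} [Lattice M] (e : L ≃o Mᵒᵈ) (α : LatticeCon M) : LatticeCon L where
  r x y := α.r (OrderDual.ofDual (e x)) (OrderDual.ofDual (e y))
  iseqv := ⟨fun _ => α.refl _, fun h => α.symm h, fun h h' => α.trans h h'⟩
  inf := fun h h' => by simpa using α.sup h h'
  sup := fun h h' => by simpa using α.inf h h'

end LatticeCon

/-! ### One wing of the lattice -/

/-- One wing of the lattice over an ordered set `Q`, without its unit. It has a zero `bot`, three
atoms `atom j` that make it nearly simple, for each `p : Q` the edge `side p false < side p true`,
and for each pair `p < q` a three-element chain of elements `gad p q k l` with `k ≤ l`. The element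
`gad p q k l` lies below `side p k` and `side q l`. -/
inductive Half (Q : Type u) [PartialOrder Q] : Type u
  | bot : Half Q
  | atom (j : Fin 3) : Half Q
  | side (p : Q) (k : Bool) : Half Q
  | gad (p q : Q) (hpq : p < q) (k l : Bool) (hkl : k → l) : Half Q

namespace Half

variable {Q : Type u} [PartialOrder Q]

/-- The order of the wing; see `Half`. -/
def Le : Half Q → Half Q → Prop
  | bot, _ => True
  | atom i, atom j => i = j
  | side p k, side q l => p = q ∧ (k → l)
  | gad p q _ k l _, gad p' q' _ k' l' _ => (p = p' ∧ q = q') ∧ (k → k') ∧ (l → l')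
  | gad p q _ k l _, side r m => (p = r ∧ (k → m)) ∨ (q = r ∧ (l → m))
  | _, _ => False

instance : PartialOrder (Half Q) where
  le := Le
  le_refl x := by cases x <;> simp [Le]
  le_trans x y z := by
    cases x <;> cases y <;> cases z <;> simp only [Le, imp_self, implies_true, false_imp_iff] <;>
      grind -order
  le_antisymm x y := by
    cases x <;> cases y <;> simp only [Le, imp_self, implies_true, false_imp_iff]
    · exact fun h _ => congrArg _ h
    · rintro ⟨rfl, h⟩ ⟨_, h'⟩
      rw [Bool.eq_iff_iff.2 ⟨h, h'⟩]
    · rintro ⟨⟨rfl, rfl⟩, h, g⟩ ⟨_, h', g'⟩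
      congr 1
      exacts [Bool.eq_iff_iff.2 ⟨h, h'⟩, Bool.eq_iff_iff.2 ⟨g, g'⟩]

theorem le_def (x y : Half Q) : x ≤ y ↔ Le x y := Iff.rfl

instance : OrderBot (Half Q) where
  bot := bot
  bot_le _ := trivial

instance [Finite Q] : Finite (Half Q) := by
  let f : Half Q → Option (Fin 3) × Option (Q × Bool) × Option (Q × Q × Bool × Bool)
    | bot => (none, none, none)
    | atom j => (some j, none, none)
    | side p k => (none, some (p, k), none)
    | gad p q _ k l _ => (none, none, some (p, q, k, l))
  refine Finite.of_injective f fun x y h => ?_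
  cases x <;> cases y <;> simp_all [f]

@[simp] theorem bot_le' (x : Half Q) : bot ≤ x := trivial

@[simp] theorem atom_le {j : Fin 3} {x : Half Q} : atom j ≤ x ↔ x = atom j := by
  cases x <;> simp [le_def, Le, eq_comm]

@[simp] theorem side_le_side {p q : Q} {k l : Bool} : side p k ≤ side q l ↔ p = q ∧ (k → l) :=
  Iff.rfl

@[simp] theorem gad_le_side {p q r : Q} {k l m : Bool} {hpq hkl} :
    gad p q hpq k l hkl ≤ side r m ↔ (p = r ∧ (k → m)) ∨ (q = r ∧ (l → m)) :=
  Iff.rfl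

theorem side_le {p : Q} {k : Bool} {x : Half Q} :
    side p k ≤ x ↔ x = side p true ∨ k = false ∧ x = side p false := by
  cases x <;> simp [le_def, Le]
  grind

/-- Two elements with an upper bound have a least one. -/
theorem exists_isLUB (x y z : Half Q) (hx : x ≤ z) (hy : y ≤ z) : ∃ w, IsLUB {x, y} w := by
  by_cases hxy : x ≤ y
  · exact ⟨y, isLUB_pair_of hxy le_rfl fun _ _ h => h⟩
  by_cases hyx : y ≤ x
  · exact ⟨x, isLUB_pair_of le_rfl hyx fun _ h _ => h⟩
  -- Incomparable elements have no common bounds but `side p k`, and `p` is determined by them.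
  by_cases h : ∃ p, x ≤ side p false ∧ y ≤ side p false
  · obtain ⟨p, hxp, hyp⟩ := h
    refine ⟨_, isLUB_pair_of hxp hyp fun w hxw hyw => ?_⟩
    clear hx hy
    cases x <;> cases y <;> cases w <;> simp only [le_def, Le] at * <;> grind -order [lt_asymm]
  by_cases h' : ∃ p, x ≤ side p true ∧ y ≤ side p true
  · obtain ⟨p, hxp, hyp⟩ := h'
    refine ⟨_, isLUB_pair_of hxp hyp fun w hxw hyw => ?_⟩
    rcases w with _ | _ | ⟨q, _ | _⟩ | _
    case side.false => exact absurd ⟨q, hxw, hyw⟩ h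
    all_goals
      clear h hx hy
      cases x <;> cases y <;> simp only [le_def, Le] at * <;> grind -order [lt_asymm]
  exfalso
  rcases z with _ | _ | ⟨p, k⟩ | _
  case side => exact h' ⟨p, hx.trans (by simp), hy.trans (by simp)⟩
  all_goals
    clear h h'
    cases x <;> cases y <;> simp only [le_def, Le] at * <;> grind -order

theorem exists_isGLB [Finite Q] (x y : Half Q) : ∃ w, IsGLB {x, y} w :=
  exists_isGLB_of_bounded_lub exists_isLUB x y

end Half

/-! ### Two wings glued together -/

/-- The five-element modular nondistributive lattice, with zero `z`, unit `u` and atoms `h`, `c`,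
`f`. Only `h` plays a special role: it lies between the edges of the two wings. -/
inductive Diamond : Type
  | z | h | c | f | u
  deriving DecidableEq

namespace Diamond

instance : Fintype Diamond := ⟨{z, h, c, f, u}, fun x => by cases x <;> simp⟩

instance : PartialOrder Diamond where
  le t s := t = z ∨ s = u ∨ t = s
  le_refl _ := Or.inr (Or.inr rfl)
  le_trans := by decide
  le_antisymm := by decide

instance : DecidableLE Diamond := fun t s => inferInstanceAs (Decidable (t = z ∨ s = u ∨ t = s))

/-- Whether an element lies above the upper end of the edge of the lower wing. -/
def lower : Diamond → Bool
  | h => true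
  | u => true
  | _ => false

/-- Whether an element lies below the lower end of the edge of the upper wing. -/
def upper : Diamond → Bool
  | z => true
  | h => true
  | _ => false

/-- The antiautomorphism that fixes the three atoms. -/
def flip : Diamond → Diamond
  | z => u
  | u => z
  | t => t

theorem lower_mono : ∀ {t s : Diamond}, t ≤ s → t.lower → s.lower := by decide
theorem upper_anti : ∀ {t s : Diamond}, t ≤ s → s.upper → t.upper := by decide
theorem flip_flip : ∀ t : Diamond, t.flip.flip = t := by decide
theorem flip_le_flip : ∀ {t s : Diamond}, t.flip ≤ s.flip ↔ s ≤ t := by decide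
theorem lower_flip : ∀ t : Diamond, t.flip.lower = t.upper := by decide
theorem upper_flip : ∀ t : Diamond, t.flip.upper = t.lower := by decide
theorem z_le : ∀ t : Diamond, z ≤ t := by decide
theorem le_u : ∀ t : Diamond, t ≤ u := by decide

theorem exists_lub : ∀ t s : Diamond, ∃ w, (t ≤ w ∧ s ≤ w ∧ ∀ v, t ≤ v → s ≤ v → w ≤ v) ∧
    (t.upper → s.upper → w.upper) := by
  decide

/-- The least element above `t` and the upper end of the edge of the lower wing. -/
def supH : Diamond → Diamond
  | z => h
  | h => h
  | _ => u

theorem le_supH : ∀ t : Diamond, t ≤ t.supH := by decide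
theorem lower_supH : ∀ t : Diamond, t.supH.lower := by decide
theorem supH_le : ∀ {t s : Diamond}, t ≤ s → s.lower → t.supH ≤ s := by decide
theorem upper_supH : ∀ t : Diamond, t.supH.upper = t.upper := by decide

end Diamond

/-- The lattice that represents `P`. The wing over the elements below `p₀` and the dual of the wing
over the elements below `p₁` are placed below and above a central element `ctr`. For each common
element `p` a copy of the five-element diamond connects the edges of color `p` in the two wings. -/
inductive Glued {P : Type u} [PartialOrder P] (p₀ p₁ : P) : Type u
  | lo (x : Half {p : P // p < p₀}) : Glued p₀ p₁
  | ctr : Glued p₀ p₁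
  | mid (p : P) (h₀ : p < p₀) (h₁ : p < p₁) (t : Diamond) : Glued p₀ p₁
  | up (y : Half {p : P // p < p₁}) : Glued p₀ p₁

namespace Glued

open Half

variable {P : Type u} [PartialOrder P] {p₀ p₁ : P}

/-- The order of the glued lattice. The upper wing is ordered dually, and a diamond lies above its
edge of the lower wing and below its edge of the upper wing. -/
def Le : Glued p₀ p₁ → Glued p₀ p₁ → Prop
  | lo x, lo y => x ≤ y
  | lo _, ctr => True
  | lo x, mid p h₀ _ t => x ≤ side ⟨p, h₀⟩ t.lower
  | lo _, up _ => True
  | ctr, ctr => True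
  | ctr, up _ => True
  | mid p _ _ t, mid q _ _ s => p = q ∧ t ≤ s
  | mid p _ h₁ t, up y => y ≤ side ⟨p, h₁⟩ t.upper
  | up x, up y => y ≤ x
  | _, _ => False

instance : PartialOrder (Glued p₀ p₁) where
  le := Le
  le_refl x := by cases x <;> simp [Le]
  le_trans x y z := by
    rcases x with x | _ | ⟨p, hp, hp', t⟩ | x <;> rcases y with y | _ | ⟨q, hq, hq', s⟩ | y <;>
      rcases z with z | _ | ⟨r, hr, hr', v⟩ | z <;>
      simp only [Le, imp_self, implies_true, false_imp_iff, true_imp_iff, imp_false]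
    · exact le_trans
    · exact le_trans
    · rintro h ⟨rfl, h'⟩
      exact h.trans (side_le_side.2 ⟨rfl, Diamond.lower_mono h'⟩)
    · rintro ⟨rfl, h⟩ ⟨rfl, h'⟩
      exact ⟨rfl, h.trans h'⟩
    · rintro ⟨rfl, h⟩ h'
      exact h'.trans (side_le_side.2 ⟨rfl, Diamond.upper_anti h⟩)
    · exact fun h h' => h'.trans h
    · exact fun h h' => h'.trans h
  le_antisymm x y := by
    rcases x with x | _ | ⟨p, hp, hp', t⟩ | x <;> rcases y with y | _ | ⟨q, hq, hq', s⟩ | y <;>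
      simp only [Le, false_imp_iff, implies_true]
    · exact fun h h' => congrArg _ (le_antisymm h h')
    · rintro ⟨rfl, h⟩ ⟨_, h'⟩
      rw [le_antisymm h h']
    · exact fun h h' => congrArg _ (le_antisymm h' h)

@[simp] theorem lo_le_lo {x y} : (lo x : Glued p₀ p₁) ≤ lo y ↔ x ≤ y := Iff.rfl
@[simp] theorem lo_le_ctr {x} : (lo x : Glued p₀ p₁) ≤ ctr := trivial
@[simp] theorem lo_le_mid {x p h₀ h₁ t} :
    (lo x : Glued p₀ p₁) ≤ mid p h₀ h₁ t ↔ x ≤ side ⟨p, h₀⟩ t.lower := Iff.rfl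
@[simp] theorem lo_le_up {x y} : (lo x : Glued p₀ p₁) ≤ up y := trivial
@[simp] theorem ctr_le_up {y} : (ctr : Glued p₀ p₁) ≤ up y := trivial
@[simp] theorem mid_le_mid {p h₀ h₁ t q g₀ g₁ s} :
    (mid p h₀ h₁ t : Glued p₀ p₁) ≤ mid q g₀ g₁ s ↔ p = q ∧ t ≤ s := Iff.rfl
@[simp] theorem mid_le_up {p h₀ h₁ t y} :
    (mid p h₀ h₁ t : Glued p₀ p₁) ≤ up y ↔ y ≤ side ⟨p, h₁⟩ t.upper := Iff.rfl
@[simp] theorem up_le_up {x y} : (up x : Glued p₀ p₁) ≤ up y ↔ y ≤ x := Iff.rfl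
@[simp] theorem not_ctr_le_lo {x} : ¬ (ctr : Glued p₀ p₁) ≤ lo x := id
@[simp] theorem not_ctr_le_mid {p h₀ h₁ t} : ¬ (ctr : Glued p₀ p₁) ≤ mid p h₀ h₁ t := id
@[simp] theorem not_mid_le_lo {p h₀ h₁ t x} : ¬ (mid p h₀ h₁ t : Glued p₀ p₁) ≤ lo x := id
@[simp] theorem not_mid_le_ctr {p h₀ h₁ t} : ¬ (mid p h₀ h₁ t : Glued p₀ p₁) ≤ ctr := id
@[simp] theorem not_up_le_lo {x y} : ¬ (up y : Glued p₀ p₁) ≤ lo x := id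
@[simp] theorem not_up_le_ctr {y} : ¬ (up y : Glued p₀ p₁) ≤ ctr := id
@[simp] theorem not_up_le_mid {y p h₀ h₁ t} : ¬ (up y : Glued p₀ p₁) ≤ mid p h₀ h₁ t := id

instance : BoundedOrder (Glued p₀ p₁) where
  bot := lo bot
  bot_le x := by cases x <;> simp
  top := up bot
  le_top x := by cases x <;> simp

theorem bot_def : (⊥ : Glued p₀ p₁) = lo bot := rfl
theorem top_def : (⊤ : Glued p₀ p₁) = up bot := rfl

/-- The exchange of the two wings. -/
def flip : Glued p₀ p₁ → Glued p₁ p₀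
  | lo x => up x
  | ctr => ctr
  | mid p h₀ h₁ t => mid p h₁ h₀ t.flip
  | up x => lo x

theorem flip_flip (x : Glued p₀ p₁) : x.flip.flip = x := by
  cases x <;> simp [flip, Diamond.flip_flip]

/-- Exchanging the two wings is an antiisomorphism. -/
def swap (p₀ p₁ : P) : Glued p₀ p₁ ≃o (Glued p₁ p₀)ᵒᵈ where
  toFun x := OrderDual.toDual x.flip
  invFun x := (OrderDual.ofDual x).flip
  left_inv := flip_flip
  right_inv := flip_flip
  map_rel_iff' {x y} := by
    cases x <;> cases y <;>
      simp [flip, Diamond.flip_le_flip, Diamond.lower_flip, Diamond.upper_flip, eq_comm]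

instance [Finite P] : Finite (Glued p₀ p₁) := by
  let f : Glued p₀ p₁ → Option (Half {p : P // p < p₀}) × Option (P × Diamond) ×
      Option (Half {p : P // p < p₁})
    | lo x => (some x, none, none)
    | ctr => (none, none, none)
    | mid p _ _ t => (none, some (p, t), none)
    | up x => (none, none, some x)
  refine Finite.of_injective f fun x y h => ?_
  cases x <;> cases y <;> simp_all [f]

variable [Finite P]

/-- In the lower wing two elements without a common bound have the join `ctr`. A join that leaves
the lower wing or a diamond is a meet of `Half`, taken in the upper wing. -/
theorem exists_isLUB (x y : Glued p₀ p₁) : ∃ w, IsLUB {x, y} w := by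
  -- Joins of elements that are not both in one wing or in one diamond.
  have lo_mid : ∀ x p h₀ h₁ t, ∃ w, IsLUB {(lo x : Glued p₀ p₁), mid p h₀ h₁ t} w := by
    intro x p h₀ h₁ t
    by_cases hf : x ≤ side ⟨p, h₀⟩ t.lower
    · exact ⟨_, isLUB_pair_of hf le_rfl fun _ _ h => h⟩
    by_cases ht : x ≤ side ⟨p, h₀⟩ true
    · refine ⟨mid p h₀ h₁ t.supH, isLUB_pair_of ?_ ?_ ?_⟩
      · simpa [Diamond.lower_supH] using ht
      · simp [Diamond.le_supH]
      · rintro (w | _ | ⟨q, _, _, s⟩ | w) hxw htw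
        · exact absurd htw id
        · exact absurd htw id
        · obtain ⟨rfl, hs⟩ := htw
          refine ⟨rfl, Diamond.supH_le hs ?_⟩
          by_contra hl
          refine hf ((lo_le_mid.1 hxw).trans (side_le_side.2 ⟨rfl, fun h => absurd h hl⟩))
        · simpa [Diamond.upper_supH] using htw
    · refine ⟨up (side ⟨p, h₁⟩ t.upper), isLUB_pair_of (by simp) (by simp) ?_⟩
      rintro (w | _ | ⟨q, _, _, s⟩ | w) hxw htw
      · exact absurd htw id
      · exact absurd htw id
      · obtain ⟨rfl, hs⟩ := htw
        exact absurd ((lo_le_mid.1 hxw).trans (side_le_side.2 ⟨rfl, fun _ => rfl⟩)) ht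
      · exact htw
  have ctr_mid : ∀ p h₀ h₁ t, ∃ w, IsLUB {(ctr : Glued p₀ p₁), mid p h₀ h₁ t} w := by
    intro p h₀ h₁ t
    refine ⟨up (side ⟨p, h₁⟩ t.upper), isLUB_pair_of (by simp) (by simp) ?_⟩
    rintro (w | _ | ⟨q, _, _, s⟩ | w) hxw htw
    exacts [absurd htw id, absurd htw id, absurd hxw id, htw]
  have mid_up : ∀ p h₀ h₁ t y, ∃ w, IsLUB {(mid p h₀ h₁ t : Glued p₀ p₁), up y} w := by
    intro p h₀ h₁ t y
    obtain ⟨g, hg⟩ := Half.exists_isGLB (side ⟨p, h₁⟩ t.upper) y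
    refine ⟨up g, isLUB_pair_of (hg.1 (by simp)) (hg.1 (by simp)) ?_⟩
    rintro (w | _ | ⟨q, _, _, s⟩ | w) hxw htw
    exacts [absurd htw id, absurd htw id, absurd htw id,
      hg.2 (by rintro _ (rfl | rfl); exacts [hxw, htw])]
  rcases x with x | _ | ⟨p, hp, hp', t⟩ | x <;> rcases y with y | _ | ⟨q, hq, hq', s⟩ | y
  case lo.lo =>
    by_cases hb : ∃ z, x ≤ z ∧ y ≤ z
    · obtain ⟨z, hxz, hyz⟩ := hb
      obtain ⟨w, hw⟩ := Half.exists_isLUB x y z hxz hyz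
      refine ⟨lo w, isLUB_pair_of (hw.1 (by simp)) (hw.1 (by simp)) ?_⟩
      rintro (v | _ | ⟨q, _, _, s⟩ | v) h h'
      exacts [hw.2 (by rintro _ (rfl | rfl); exacts [h, h']), trivial,
        hw.2 (by rintro _ (rfl | rfl); exacts [h, h']), trivial]
    · refine ⟨ctr, isLUB_pair_of trivial trivial ?_⟩
      rintro (v | _ | ⟨q, _, _, s⟩ | v) h h'
      exacts [absurd ⟨_, h, h'⟩ hb, trivial, absurd ⟨_, h, h'⟩ hb, trivial]
  case lo.mid => exact lo_mid ..
  case mid.lo => rw [Set.pair_comm]; exact lo_mid ..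
  case ctr.mid => exact ctr_mid ..
  case mid.ctr => rw [Set.pair_comm]; exact ctr_mid ..
  case mid.up => exact mid_up ..
  case up.mid => rw [Set.pair_comm]; exact mid_up ..
  case mid.mid =>
    by_cases hpq : p = q
    · subst hpq
      obtain ⟨w, ⟨h1, h2, h3⟩, h4⟩ := Diamond.exists_lub t s
      refine ⟨mid p hp hp' w, isLUB_pair_of ⟨rfl, h1⟩ ⟨rfl, h2⟩ ?_⟩
      rintro (v | _ | ⟨q, _, _, s⟩ | v) h h'
      · exact absurd h id
      · exact absurd h id
      · exact ⟨h.1, h3 _ h.2 h'.2⟩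
      · obtain ⟨k, hk⟩ : ∃ k : Bool, (k → t.upper) ∧ (k → s.upper) ∧ v ≤ side ⟨p, hp'⟩ k := by
          rcases ht : t.upper with _ | _
          · exact ⟨false, by simp, by simp, by simpa [ht] using h⟩
          · exact ⟨s.upper, by simp, by simp, h'⟩
        exact hk.2.2.trans (side_le_side.2 ⟨rfl, fun hk' => h4 (hk.1 hk') (hk.2.1 hk')⟩)
    · obtain ⟨g, hg⟩ := Half.exists_isGLB (side (⟨p, hp'⟩ : {p : P // p < p₁}) t.upper)
        (side ⟨q, hq'⟩ s.upper)
      refine ⟨up g, isLUB_pair_of (hg.1 (by simp)) (hg.1 (by simp)) ?_⟩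
      rintro (w | _ | ⟨q, _, _, s⟩ | w) hxw htw
      exacts [absurd htw id, absurd htw id, absurd (hxw.1.trans htw.1.symm) hpq,
        hg.2 (by rintro _ (rfl | rfl); exacts [hxw, htw])]
  case up.up =>
    obtain ⟨g, hg⟩ := Half.exists_isGLB x y
    refine ⟨up g, isLUB_pair_of (hg.1 (by simp)) (hg.1 (by simp)) ?_⟩
    rintro (w | _ | ⟨q, _, _, s⟩ | w) hxw htw
    exacts [absurd htw id, absurd htw id, absurd htw id,
      hg.2 (by rintro _ (rfl | rfl); exacts [hxw, htw])]
  case lo.ctr => exact ⟨_, isLUB_pair_of lo_le_ctr le_rfl fun _ _ h => h⟩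
  case lo.up => exact ⟨_, isLUB_pair_of lo_le_up le_rfl fun _ _ h => h⟩
  case ctr.ctr => exact ⟨_, isLUB_pair_of le_rfl le_rfl fun _ _ h => h⟩
  case ctr.up => exact ⟨_, isLUB_pair_of ctr_le_up le_rfl fun _ _ h => h⟩
  case ctr.lo => exact ⟨_, isLUB_pair_of le_rfl trivial fun _ h _ => h⟩
  case up.lo => exact ⟨_, isLUB_pair_of le_rfl trivial fun _ h _ => h⟩
  case up.ctr => exact ⟨_, isLUB_pair_of le_rfl trivial fun _ h _ => h⟩

noncomputable instance : Lattice (Glued p₀ p₁) := latticeOfExistsLUB _ exists_isLUB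

end Glued

/-! ### Congruences of the glued lattice -/

namespace Half

variable {Q : Type u} [PartialOrder Q]

/-- The greatest element that agrees with `x` after the edges with color in `D` are collapsed. -/
def top (D : Q → Bool) : Half Q → Half Q
  | bot => bot
  | atom j => atom j
  | side p k => side p (k || D p)
  | gad p q h k l hkl => gad p q h (k || (D p && (l || D q))) (l || D q) (by grind)

/-- The least element that agrees with `x` after the edges with color in `D` are collapsed. -/
def bottom (D : Q → Bool) : Half Q → Half Q
  | bot => bot
  | atom j => atom j
  | side p k => side p (k && !D p)
  | gad p q h k l hkl => gad p q h (k && !D p && !D q) (l && !D q) (by grind)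

variable {D : Q → Bool}

theorem top_mono (hD : ∀ p q, p < q → D q → D p) : Monotone (top D) := by
  intro x y h
  cases x <;> cases y <;> simp only [le_def, Le, top] at * <;> grind -order

theorem bottom_mono (hD : ∀ p q, p < q → D q → D p) : Monotone (bottom D) := by
  intro x y h
  cases x <;> cases y <;> simp only [le_def, Le, bottom] at * <;> grind -order

theorem le_top (x : Half Q) : x ≤ top D x := by
  cases x <;> simp [le_def, Le, top] <;> grind

theorem bottom_le (x : Half Q) : bottom D x ≤ x := by
  cases x <;> simp [le_def, Le, bottom] <;> grind

theorem top_bottom (hD : ∀ p q, p < q → D q → D p) (x : Half Q) : top D (bottom D x) = top D x := by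
  cases x <;> simp [top, bottom] <;> grind

theorem bottom_top (hD : ∀ p q, p < q → D q → D p) (x : Half Q) :
    bottom D (top D x) = bottom D x := by
  cases x <;> simp [top, bottom] <;> grind

end Half

namespace Glued

open Half

variable {P : Type u} [PartialOrder P] [Finite P] {p₀ p₁ : P}

/-- The congruence that collapses the edges of the wings with color in a lower set `D` and the
diamonds over `D`, and nothing else. -/
noncomputable def sideCon (D : P → Bool) (hD : ∀ p q, p < q → D q → D p) :
    LatticeCon (Glued p₀ p₁) :=
  LatticeCon.ofClosure
    (fun
      | lo x => lo (top (fun p => D p) x)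
      | ctr => ctr
      | mid p h₀ h₁ t => mid p h₀ h₁ (if D p then .u else t)
      | up y => up (bottom (fun p => D p) y))
    (fun
      | lo x => lo (bottom (fun p => D p) x)
      | ctr => ctr
      | mid p h₀ h₁ t => mid p h₀ h₁ (if D p then .z else t)
      | up y => up (top (fun p => D p) y))
    (by
      have h0 := top_mono (Q := {p : P // p < p₀}) (D := fun p => D p) fun p q h => hD p q h
      have h1 := bottom_mono (Q := {p : P // p < p₁}) (D := fun p => D p) fun p q h => hD p q h
      intro x y h
      rcases x with x | _ | ⟨p, hp, hp', t⟩ | x <;> rcases y with y | _ | ⟨q, hq, hq', s⟩ | y <;>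
        try simp at h ⊢
      · exact h0 h
      · refine (h0 h).trans ?_
        simp only [top, side_le_side, true_and]
        split_ifs with hq <;> simp [hq, Diamond.lower]
      · obtain ⟨rfl, h⟩ := h
        refine ⟨rfl, ?_⟩
        split_ifs
        exacts [le_rfl, h]
      · refine (h1 h).trans ?_
        simp only [bottom, side_le_side, true_and]
        split_ifs with hq <;> simp [hq, Diamond.upper]
      · exact h1 h)
    (by
      have h0 := bottom_mono (Q := {p : P // p < p₀}) (D := fun p => D p) fun p q h => hD p q h
      have h1 := top_mono (Q := {p : P // p < p₁}) (D := fun p => D p) fun p q h => hD p q h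
      intro x y h
      rcases x with x | _ | ⟨p, hp, hp', t⟩ | x <;> rcases y with y | _ | ⟨q, hq, hq', s⟩ | y <;>
        try simp at h ⊢
      · exact h0 h
      · refine (h0 h).trans ?_
        simp only [bottom, side_le_side, true_and]
        split_ifs with hq <;> simp [hq, Diamond.lower]
      · obtain ⟨rfl, h⟩ := h
        refine ⟨rfl, ?_⟩
        split_ifs
        exacts [le_rfl, h]
      · refine (h1 h).trans ?_
        simp only [top, side_le_side, true_and]
        split_ifs with hq <;> simp [hq, Diamond.upper]
      · exact h1 h)
    (by
      rintro (x | _ | ⟨p, hp, hp', t⟩ | x) <;> simp [Half.le_top, Half.bottom_le]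
      split_ifs
      exacts [Diamond.le_u _, le_rfl])
    (by
      rintro (x | _ | ⟨p, hp, hp', t⟩ | x) <;> simp [Half.le_top, Half.bottom_le]
      split_ifs
      exacts [Diamond.z_le _, le_rfl])
    (by
      rintro (x | _ | ⟨p, hp, hp', t⟩ | x) <;> simp
      · exact top_bottom (Q := {p : P // p < p₀}) (D := fun p => D p)
          (fun p q h => hD p q h) x
      · grind
      · exact bottom_top (Q := {p : P // p < p₁}) (D := fun p => D p)
          (fun p q h => hD p q h) x)
    (by
      rintro (x | _ | ⟨p, hp, hp', t⟩ | x) <;> simp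
      · exact bottom_top (Q := {p : P // p < p₀}) (D := fun p => D p)
          (fun p q h => hD p q h) x
      · grind
      · exact top_bottom (Q := {p : P // p < p₁}) (D := fun p => D p)
          (fun p q h => hD p q h) x)

open Classical in
/-- The greatest element that agrees with `lo x` after the upper wing, all diamonds, and the edges
with color in `D` are collapsed. -/
noncomputable def loTop (D : P → Bool) : Half {p : P // p < p₀} → Glued p₀ p₁
  | side p k => if h : p.1 < p₁ then mid p p.2 h .u else lo (top (fun p => D p) (side p k))
  | x => lo (top (fun p => D p) x)

omit [Finite P] in
theorem loTop_mono {D : P → Bool} (hD : ∀ p q, p < q → D q → D p) :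
    Monotone (loTop D : Half {p : P // p < p₀} → Glued p₀ p₁) := by
  have h0 := top_mono (Q := {p : P // p < p₀}) (D := fun p => D p) fun p q h => hD p q h
  intro x y h
  rcases y with _ | _ | ⟨q, l⟩ | _
  case side =>
    by_cases hq : q.1 < p₁
    · have hx := (h0 h).trans (side_le_side.2 ⟨rfl, fun _ => rfl⟩ : _ ≤ side q true)
      rcases x with _ | _ | ⟨p, k⟩ | _
      case side =>
        obtain rfl := (side_le_side.1 h).1
        simp [loTop, hq]
      case bot => simp [loTop, top, hq]
      all_goals simpa [loTop, hq, Diamond.lower] using hx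
    · have hx := h0 h
      rcases x with _ | _ | ⟨p, k⟩ | _
      case side =>
        obtain rfl := (side_le_side.1 h).1
        simpa [loTop, hq] using hx
      case bot => simp [loTop, top, hq]
      all_goals simpa [loTop, hq] using hx
  all_goals
    have hx := h0 h
    rcases x with _ | _ | ⟨p, k⟩ | _
    case side => simp [le_def, Half.Le] at h
    case bot => simp [loTop, top]
    all_goals simpa [loTop] using hx

/-- The congruence that collapses the upper wing, all diamonds, and the edges of the lower wing with
color in a lower set `D` that contains the colors of the diamonds, and nothing else in the
lower wing. -/
noncomputable def upperCon (D : P → Bool) (hD : ∀ p q, p < q → D q → D p)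
    (hD₁ : ∀ p, p < p₁ → D p) : LatticeCon (Glued p₀ p₁) :=
  LatticeCon.ofClosure
    (fun
      | lo x => loTop D x
      | ctr => up bot
      | mid p h₀ h₁ _ => mid p h₀ h₁ .u
      | up _ => up bot)
    (fun
      | lo x => lo (bottom (fun p => D p) x)
      | ctr => ctr
      | mid p h₀ _ _ => lo (side ⟨p, h₀⟩ false)
      | up _ => ctr)
    (by
      have h0 := loTop_mono (p₀ := p₀) (p₁ := p₁) hD
      have htop : ∀ z : Glued p₀ p₁, z ≤ up bot := fun z => le_top
      intro x y h
      rcases x with x | _ | ⟨p, hp, hp', t⟩ | x <;> rcases y with y | _ | ⟨q, hq, hq', s⟩ | y <;>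
        try first | exact htop _ | exact absurd h id
      · exact h0 h
      · simpa [loTop, hq'] using h0 (lo_le_mid.1 h)
      · exact ⟨h.1, le_rfl⟩)
    (by
      have h0 := bottom_mono (Q := {p : P // p < p₀}) (D := fun p => D p) fun p q h => hD p q h
      intro x y h
      rcases x with x | _ | ⟨p, hp, hp', t⟩ | x <;> rcases y with y | _ | ⟨q, hq, hq', s⟩ | y <;>
        try simp at h ⊢
      · exact h0 h
      · refine (h0 h).trans ?_
        simp [bottom, hD₁ q hq']
      · exact h.1)
    (by
      rintro ((_ | _ | ⟨p, k⟩ | _) | _ | ⟨p, hp, hp', t⟩ | x) <;>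
        simp [loTop, Half.le_top, Diamond.le_u]
      split_ifs <;> simp [Half.le_top, Diamond.lower])
    (by
      rintro (x | _ | ⟨p, hp, hp', t⟩ | x) <;> simp [Half.bottom_le])
    (by
      have := top_bottom (Q := {p : P // p < p₀}) (D := fun p => D p) fun p q h => hD p q h
      rintro ((_ | _ | ⟨p, k⟩ | _) | _ | ⟨p, hp, hp', t⟩ | x)
      case lo.side =>
        by_cases h : p.1 < p₁
        · simp [loTop, h, bottom]
        · simpa [loTop, h, bottom] using this (side p k)
      case mid => simp [loTop, hp']
      all_goals first | rfl | exact congrArg lo (this _))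
    (by
      have := bottom_top (Q := {p : P // p < p₀}) (D := fun p => D p) fun p q h => hD p q h
      rintro ((_ | _ | ⟨p, k⟩ | _) | _ | ⟨p, hp, hp', t⟩ | x)
      case lo.side =>
        by_cases h : p.1 < p₁
        · simp [loTop, h, bottom, hD₁ p h]
        · simpa [loTop, h] using this (side p k)
      all_goals first | rfl | exact congrArg lo (this _))

end Glued

/-! ### Edges that generate the congruences -/

namespace Glued

open Half LatticeCon

variable {P : Type u} [PartialOrder P] [Finite P] {p₀ p₁ : P}

/-- The congruence of the antiisomorphic lattice that corresponds to `α`. -/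
noncomputable def dual (α : LatticeCon (Glued p₀ p₁)) : LatticeCon (Glued p₁ p₀) :=
  α.comapDual (swap p₁ p₀)

omit [Finite P] in
theorem exists_atom_ne (x y : Half {p : P // p < p₀}) : ∃ j, atom j ≠ x ∧ atom j ≠ y := by
  have key : ∀ a b : Fin 3, ∃ j, j ≠ a ∧ j ≠ b := by decide
  have h : ∀ x : Half {p : P // p < p₀}, ∃ a, ∀ j, j ≠ a → atom j ≠ x := by
    rintro (_ | a | _ | _)
    case atom => exact ⟨a, fun j hj h => hj (by injection h)⟩
    all_goals exact ⟨0, by simp⟩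
  obtain ⟨a, ha⟩ := h x
  obtain ⟨b, hb⟩ := h y
  obtain ⟨j, hja, hjb⟩ := key a b
  exact ⟨j, ha j hja, hb j hjb⟩

omit [Finite P] in
theorem le_atom {j : Fin 3} {w : Glued p₀ p₁} (h : w ≤ lo (atom j)) :
    w = lo bot ∨ w = lo (atom j) := by
  rcases w with (_ | i | _ | _) | _ | _ | _
  case lo.atom => exact Or.inr (congrArg (lo ∘ atom) h)
  case lo.bot => exact Or.inl rfl
  all_goals exact absurd h id

omit [Finite P] in
theorem ctr_le_of_atom_le {j : Fin 3} {w : Glued p₀ p₁} (h : lo (atom j) ≤ w)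
    (hw : w ≠ lo (atom j)) : ctr ≤ w := by
  rcases w with x | _ | ⟨p, hp, hp', t⟩ | _
  · exact absurd (congrArg lo (atom_le.1 h)) hw
  · exact le_rfl
  · exact absurd (atom_le.1 (lo_le_mid.1 h)) (by simp)
  · exact ctr_le_up

/-- Collapsing a nonzero `x` with the zero of the lower wing collapses the lower wing: an atom other
than `x` is a complement of `x`, and a third atom is a complement of both. -/
theorem rel_bot_ctr (α : LatticeCon (Glued p₀ p₁)) {x} (hx : x ≠ bot)
    (h : α.r (lo bot) (lo x)) : α.r (lo bot) ctr := by
  have hup : ∀ {x j}, x ≠ bot → atom j ≠ x → α.r (lo bot) (lo x) → α.r (lo (atom j)) ctr := by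
    intro x j hx hj h
    refine α.rel_up h (by simp) (by simp) fun w hw hxw => ctr_le_of_atom_le hw ?_
    rintro rfl
    rcases le_atom hxw with h | h
    exacts [hx (by injection h), hj (by injection h with h; exact h.symm)]
  obtain ⟨j, hj, -⟩ := exists_atom_ne x x
  obtain ⟨k, hk, hkj⟩ := exists_atom_ne x (atom j)
  have h1 := hup hx hj h
  have h2 : α.r (lo bot) (lo (atom k)) := by
    refine α.rel_down h1 (by simp) (by simp) fun w hw hwj => ?_
    rcases le_atom hw with rfl | rfl
    · exact le_rfl
    · exact absurd (atom_le.1 (lo_le_lo.1 hwj)).symm hkj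
  exact α.trans h2 (hup hx hk h)

theorem rel_ctr_iff (α : LatticeCon (Glued p₀ p₁)) (x) :
    α.r (lo x) ctr ↔ α.r (lo bot) ctr := by
  refine ⟨fun h => ?_, fun h => α.rel_of_le h (by simp) (by simp) le_rfl⟩
  obtain ⟨j, hj, -⟩ := exists_atom_ne x x
  refine rel_bot_ctr α (x := atom j) (by simp) ?_
  refine α.rel_down h (by simp) (by simp) fun w hw hwx => ?_
  rcases le_atom hw with rfl | rfl
  · exact le_rfl
  · exact absurd (atom_le.1 (lo_le_lo.1 hwx)).symm hj

theorem rel_ctr_up_iff (α : LatticeCon (Glued p₀ p₁)) (y) :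
    α.r ctr (up y) ↔ α.r ctr (up bot) :=
  ⟨fun h => α.symm ((rel_ctr_iff (dual α) y).1 (α.symm h)),
    fun h => α.symm ((rel_ctr_iff (dual α) y).2 (α.symm h))⟩

/-- `α` collapses the edge of color `p` in the lower wing. -/
def LowerEdge (α : LatticeCon (Glued p₀ p₁)) (p : {p : P // p < p₀}) : Prop :=
  α.r (lo (side p false)) (lo (side p true))

/-- `α` collapses the edge of color `p` in the upper wing. -/
def UpperEdge (α : LatticeCon (Glued p₀ p₁)) (p : {p : P // p < p₁}) : Prop :=
  α.r (up (side p true)) (up (side p false))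

theorem lowerEdge_dual (α : LatticeCon (Glued p₀ p₁)) (p) :
    LowerEdge (dual α) p ↔ UpperEdge α p := ⟨fun h => α.symm h, fun h => α.symm h⟩

theorem upperEdge_dual (α : LatticeCon (Glued p₀ p₁)) (p) :
    UpperEdge (dual α) p ↔ LowerEdge α p := ⟨fun h => α.symm h, fun h => α.symm h⟩

omit [Finite P] in
theorem side_le_iff {p : {p : P // p < p₀}} {k : Bool} {w : Glued p₀ p₁} : lo (side p k) ≤ w ↔
    w = lo (side p true) ∨ (k = false ∧ w = lo (side p false)) ∨ ctr ≤ w ∨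
      ∃ (h : p.1 < p₁) (t : Diamond), w = (mid p.1 p.2 h t : Glued p₀ p₁) ∧ (k → t.lower) := by
  rcases w with x | _ | ⟨q, hq, hq', t⟩ | _
  · simp [side_le]
  · simp
  · obtain ⟨p, hp⟩ := p
    simp only [lo_le_mid, side_le_side, Subtype.mk.injEq, reduceCtorEq, and_false, not_ctr_le_mid,
      false_or]
    constructor
    · rintro ⟨rfl, h⟩
      exact ⟨hq', t, rfl, h⟩
    · rintro ⟨h, s, hs, h'⟩
      injection hs with h1 h2
      subst h1 h2
      exact ⟨rfl, h'⟩
  · simp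

/-- Collapsing the edge of the lower wing collapses `z` and `h` in the diamond, and the diamond is
simple. -/
theorem mid_of_lowerEdge (α : LatticeCon (Glued p₀ p₁)) {p} (h₀ : p < p₀) (h₁ : p < p₁)
    (h : LowerEdge α ⟨p, h₀⟩) : α.r (mid p h₀ h₁ .z) (mid p h₀ h₁ .u) := by
  have zh : α.r (mid p h₀ h₁ .z) (mid p h₀ h₁ .h) := by
    refine α.rel_up h (by simp) (by simp [Diamond.z_le]) fun w hzw hw => ?_
    rcases w with x | _ | ⟨q, hq, hq', t⟩ | _
    · exact hzw
    · exact hzw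
    · obtain ⟨rfl, -⟩ := mid_le_mid.1 hzw
      exact ⟨rfl, Diamond.supH_le (Diamond.z_le t) ((side_le_side.1 (lo_le_mid.1 hw)).2 rfl)⟩
    · exact hzw
  have fu : α.r (mid p h₀ h₁ .f) (mid p h₀ h₁ .u) := by
    refine α.rel_up zh (by simp [Diamond.z_le]) (by simp [Diamond.le_u]) fun w hfw hw => ?_
    rcases w with x | _ | ⟨q, hq, hq', t⟩ | _
    · exact hfw
    · exact hfw
    · have key : ∀ {t : Diamond}, .f ≤ t → .h ≤ t → .u ≤ t := by decide
      exact ⟨hfw.1, key hfw.2 hw.2⟩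
    · exact hfw
  have zc : α.r (mid p h₀ h₁ .z) (mid p h₀ h₁ .c) := by
    refine α.rel_down fu (by simp [Diamond.le_u]) (by simp [Diamond.z_le]) fun w hcw hw => ?_
    rcases w with x | _ | ⟨q, hq, hq', t⟩ | _
    · exact hcw
    · exact hcw
    · have key : ∀ {t : Diamond}, t ≤ .c → t ≤ .f → t ≤ .z := by decide
      exact ⟨hcw.1, key hcw.2 hw.2⟩
    · exact hcw
  have hu : α.r (mid p h₀ h₁ .h) (mid p h₀ h₁ .u) := by
    refine α.rel_up zc (by simp [Diamond.z_le]) (by simp [Diamond.le_u]) fun w hhw hw => ?_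
    rcases w with x | _ | ⟨q, hq, hq', t⟩ | _
    · exact hhw
    · exact hhw
    · have key : ∀ {t : Diamond}, .h ≤ t → .c ≤ t → .u ≤ t := by decide
      exact ⟨hhw.1, key hhw.2 hw.2⟩
    · exact hw
  exact α.trans zh hu

/-- A pair of a diamond that meets the lower wing in its edge. -/
theorem lowerEdge_of_mid (α : LatticeCon (Glued p₀ p₁)) {p} (h₀ : p < p₀) (h₁ : p < p₁)
    {t s : Diamond} (ht : t.lower = false) (hs : s.lower = true)
    (h : α.r (mid p h₀ h₁ t) (mid p h₀ h₁ s)) : LowerEdge α ⟨p, h₀⟩ := by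
  refine α.rel_down h (by simp [hs]) (by simp) fun w hw hwt => ?_
  rcases w with x | _ | _ | _
  · rwa [lo_le_mid, ht] at hwt
  all_goals exact absurd hw id

/-- A pair of a diamond that joins the upper wing in its edge. -/
theorem upperEdge_of_mid (α : LatticeCon (Glued p₀ p₁)) {p} (h₀ : p < p₀) (h₁ : p < p₁)
    {t s : Diamond} (ht : t.upper = true) (hs : s.upper = false)
    (h : α.r (mid p h₀ h₁ t) (mid p h₀ h₁ s)) : UpperEdge α ⟨p, h₁⟩ := by
  refine α.rel_up h (by simp [ht]) (by simp) fun w hw hwt => ?_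
  rcases w with _ | _ | _ | x
  case up => rwa [mid_le_up, hs] at hwt
  all_goals exact absurd hw id

theorem lowerEdge_iff_upperEdge (α : LatticeCon (Glued p₀ p₁)) {p} (h₀ : p < p₀) (h₁ : p < p₁) :
    LowerEdge α ⟨p, h₀⟩ ↔ UpperEdge α ⟨p, h₁⟩ := by
  have key : ∀ {p₀ p₁ : P} (α : LatticeCon (Glued p₀ p₁)) {p} (h₀ : p < p₀) (h₁ : p < p₁),
      LowerEdge α ⟨p, h₀⟩ → UpperEdge α ⟨p, h₁⟩ :=
    fun α _ h₀ h₁ h => upperEdge_of_mid α h₀ h₁ (by rfl) (by rfl) (mid_of_lowerEdge α h₀ h₁ h)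
  exact ⟨key α h₀ h₁, fun h =>
    (upperEdge_dual α _).1 (key (dual α) h₁ h₀ ((lowerEdge_dual α _).2 h))⟩

theorem lowerEdge_of_rel {α : LatticeCon (Glued p₀ p₁)} {r x y} (hx : x ≤ side r false)
    (hy : ¬ y ≤ side r false) (h : α.r (lo x) (lo y)) : LowerEdge α r := by
  refine α.rel_up h hx (by simp) fun w hw hyw => ?_
  rcases side_le_iff.1 hw with rfl | ⟨-, rfl⟩ | hc | ⟨h, t, rfl, -⟩
  · exact le_rfl
  · exact absurd hyw hy
  · exact lo_le_ctr.trans hc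
  · rw [lo_le_mid] at hyw ⊢
    rcases ht : t.lower with _ | _
    · exact absurd (ht ▸ hyw) hy
    · exact le_rfl

theorem rel_of_lowerEdge {α : LatticeCon (Glued p₀ p₁)} {r x y} (hxy : x ≤ y)
    (hy : y ≤ side r true) (h : ∀ w, w ≤ y → w ≤ side r false → w ≤ x) (hα : LowerEdge α r) :
    α.r (lo x) (lo y) := by
  refine α.rel_down hα hy hxy fun w hw hwr => ?_
  rcases w with w | _ | _ | _
  · exact h w hw hwr
  all_goals exact absurd hw id

/-- The gadget over `p < q` transfers the edge of color `q` to the edge of color `p`. -/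
theorem LowerEdge.of_lt {α : LatticeCon (Glued p₀ p₁)} {p q} (hpq : p < q) (h : LowerEdge α q) :
    LowerEdge α p := by
  refine lowerEdge_of_rel (x := gad p q hpq false false (by simp))
    (y := gad p q hpq true true (by simp)) (by simp) (by simp [hpq.ne'])
    (rel_of_lowerEdge (by simp [le_def, Half.Le]) (by simp) (fun w hw hwq => ?_) h)
  rcases w with _ | _ | _ | _ <;> simp [le_def, Half.Le] at hw hwq ⊢
  grind

/-- Collapsing an end `side r m` of an edge with an element below it that is not on that edge
collapses the lower wing. -/
theorem rel_side_iff (α : LatticeCon (Glued p₀ p₁)) {x r m} (hx : x ≤ side r m)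
    (hxr : ∀ k, x ≠ side r k) : α.r (lo x) (lo (side r m)) ↔ α.r (lo bot) ctr := by
  refine ⟨fun h => ?_, fun h => α.rel_of_le h (by simp) hx (by simp)⟩
  rcases x with _ | j | ⟨p, k⟩ | ⟨p, q, hpq, k, l, hkl⟩
  · exact rel_bot_ctr α (by simp) h
  · exact absurd hx id
  · exact absurd (by rw [(side_le_side.1 hx).1]) (hxr k)
  · -- The other edge above the gadget has join `ctr` with `side r m`.
    obtain ⟨s, hs, hsr⟩ : ∃ s, gad p q hpq k l hkl ≤ side s true ∧ s ≠ r := by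
      rcases gad_le_side.1 hx with ⟨rfl, -⟩ | ⟨rfl, -⟩
      · exact ⟨q, by simp, hpq.ne'⟩
      · exact ⟨p, by simp, hpq.ne⟩
    refine (rel_ctr_iff α (side s true)).1 ?_
    refine α.rel_up h hs (by simp) fun w hw hwr => ?_
    rcases side_le_iff.1 hw with rfl | ⟨h, -⟩ | hc | ⟨h, t, rfl, -⟩
    · exact absurd hwr (by simp [hsr.symm])
    · exact absurd h (by simp)
    · exact hc
    · exact absurd hwr (by simp [Subtype.ext_iff] at hsr ⊢; simp [Ne.symm hsr])

/-- An interval of the lower wing is generated by the whole wing or by an edge. -/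
theorem lo_lo_color {x y : Half {p : P // p < p₀}} (hxy : x < y) :
    (∀ α : LatticeCon (Glued p₀ p₁), α.r (lo x) (lo y) ↔ α.r (lo bot) ctr) ∨
      ∃ p, ∀ α : LatticeCon (Glued p₀ p₁), α.r (lo x) (lo y) ↔ LowerEdge α p := by
  have back : ∀ α : LatticeCon (Glued p₀ p₁), α.r (lo bot) ctr → α.r (lo x) (lo y) :=
    fun α h => α.rel_of_le h (by simp) hxy.le (by simp)
  rcases x with _ | j | ⟨p, k⟩ | ⟨p, q, hpq, k, l, hkl⟩
  · exact Or.inl fun α => ⟨fun h => rel_bot_ctr α hxy.ne' h, back α⟩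
  · exact absurd (atom_le.1 hxy.le) hxy.ne'
  · have h1 : y = side p true ∧ k = false := by
      rcases side_le.1 hxy.le with rfl | ⟨rfl, rfl⟩
      · exact ⟨rfl, by by_contra h; simp at h; exact hxy.ne (by rw [h])⟩
      · exact absurd rfl hxy.ne
    rw [h1.1, h1.2]
    exact Or.inr ⟨p, fun α => Iff.rfl⟩
  · rcases y with _ | _ | ⟨r, m⟩ | ⟨p', q', hpq', k', l', hkl'⟩
    · exact absurd hxy.le id
    · exact absurd hxy.le id
    · exact Or.inl fun α => rel_side_iff α hxy.le (by simp)
    · right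
      obtain ⟨⟨rfl, rfl⟩, hk, hl⟩ := hxy.le
      have hne : ¬ (k = k' ∧ l = l') := by
        rintro ⟨rfl, rfl⟩
        exact hxy.ne rfl
      rcases l with _ | _ <;> rcases l' with _ | _ <;> rcases k with _ | _ <;>
        rcases k' with _ | _ <;> simp at hk hl hkl hkl' hne
      · refine ⟨q, fun α => ⟨lowerEdge_of_rel (by simp) (by simp [hpq.ne]),
          rel_of_lowerEdge hxy.le (by simp) fun w hw hwq => ?_⟩⟩
        rcases w with _ | _ | _ | _ <;> simp [le_def, Half.Le] at hw hwq ⊢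
        grind
      · refine ⟨q, fun α => ⟨lowerEdge_of_rel (by simp) (by simp [hpq.ne]),
          rel_of_lowerEdge hxy.le (by simp) fun w hw hwq => ?_⟩⟩
        rcases w with _ | _ | _ | _ <;> simp [le_def, Half.Le] at hw hwq ⊢
        grind
      · refine ⟨p, fun α => ⟨lowerEdge_of_rel (by simp) (by simp [hpq.ne']),
          rel_of_lowerEdge hxy.le (by simp) fun w hw hwq => ?_⟩⟩
        rcases w with _ | _ | _ | _ <;> simp [le_def, Half.Le] at hw hwq ⊢
        grind

end Glued

/-! ### The congruence lattice -/

namespace Glued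

open Half LatticeCon

variable {P : Type u} [PartialOrder P] [Finite P] {p₀ p₁ : P}

/-- `α` collapses the edges of color `p`. Color `p₀` stands for the lower wing, color `p₁` for the
upper wing. -/
def Collapses (α : LatticeCon (Glued p₀ p₁)) (p : P) : Prop :=
  (p = p₀ → α.r (lo bot) ctr) ∧ (p = p₁ → α.r ctr (up bot)) ∧
    (∀ h : p < p₀, LowerEdge α ⟨p, h⟩) ∧ ∀ h : p < p₁, UpperEdge α ⟨p, h⟩

theorem collapses_dual (α : LatticeCon (Glued p₀ p₁)) (p : P) :
    Collapses (dual α) p ↔ Collapses α p := by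
  have h0 : (dual α).r (lo bot) ctr ↔ α.r ctr (up bot) := ⟨fun h => α.symm h, fun h => α.symm h⟩
  have h1 : (dual α).r ctr (up bot) ↔ α.r (lo bot) ctr := ⟨fun h => α.symm h, fun h => α.symm h⟩
  simp only [Collapses, lowerEdge_dual, upperEdge_dual, h0, h1]
  tauto

theorem Collapses.mono {α β : LatticeCon (Glued p₀ p₁)} (h : α ≤ β) {p : P}
    (hα : Collapses α p) : Collapses β p :=
  ⟨fun hp => h _ _ (hα.1 hp), fun hp => h _ _ (hα.2.1 hp), fun hp => h _ _ (hα.2.2.1 hp),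
    fun hp => h _ _ (hα.2.2.2 hp)⟩

theorem collapses_of_lt_left (α : LatticeCon (Glued p₀ p₁)) (h10 : ¬ p₁ ≤ p₀) {p : P}
    (h : p < p₀) : Collapses α p ↔ LowerEdge α ⟨p, h⟩ :=
  ⟨fun hα => hα.2.2.1 h, fun hα => ⟨fun hp => absurd hp h.ne, fun hp => absurd (hp ▸ h.le) h10,
    fun _ => hα, fun h' => (lowerEdge_iff_upperEdge α h h').1 hα⟩⟩

theorem collapses_of_lt_right (α : LatticeCon (Glued p₀ p₁)) (h01 : ¬ p₀ ≤ p₁) {p : P}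
    (h : p < p₁) : Collapses α p ↔ UpperEdge α ⟨p, h⟩ := by
  rw [← collapses_dual, collapses_of_lt_left _ h01 h, lowerEdge_dual]

theorem collapses_left (α : LatticeCon (Glued p₀ p₁)) (h01 : ¬ p₀ ≤ p₁) :
    Collapses α p₀ ↔ α.r (lo bot) ctr :=
  ⟨fun hα => hα.1 rfl, fun hα => ⟨fun _ => hα, fun hp => absurd hp.le h01,
    fun h => absurd h (lt_irrefl _), fun h => absurd h.le h01⟩⟩

theorem collapses_right (α : LatticeCon (Glued p₀ p₁)) (h10 : ¬ p₁ ≤ p₀) :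
    Collapses α p₁ ↔ α.r ctr (up bot) :=
  ⟨fun hα => hα.2.1 rfl, fun hα => ⟨fun hp => absurd hp.le h10, fun _ => hα,
    fun h => absurd h.le h10, fun h => absurd h (lt_irrefl _)⟩⟩

theorem Collapses.of_le {α : LatticeCon (Glued p₀ p₁)} (h01 : ¬ p₀ ≤ p₁) (h10 : ¬ p₁ ≤ p₀)
    {p q : P} (hle : q ≤ p₀ ∨ q ≤ p₁) (hpq : p ≤ q) (h : Collapses α q) : Collapses α p := by
  rcases hpq.eq_or_lt with rfl | hpq
  · exact h
  -- The upper wing is the lower wing of the antiisomorphic lattice.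
  have key : ∀ {p₀ p₁ : P} {α : LatticeCon (Glued p₀ p₁)}, ¬ p₀ ≤ p₁ → ¬ p₁ ≤ p₀ → q ≤ p₀ →
      Collapses α q → Collapses α p := by
    intro p₀ p₁ α h01 h10 hq h
    rw [collapses_of_lt_left α h10 (hpq.trans_le hq)]
    rcases hq.eq_or_lt with rfl | hq
    · exact α.rel_of_le (h.1 rfl) (by simp) (by simp) (by simp)
    · exact LowerEdge.of_lt hpq (h.2.2.1 hq)
  rcases hle with hq | hq
  · exact key h01 h10 hq h
  · exact (collapses_dual α p).1 (key h10 h01 hq ((collapses_dual α q).2 h))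

/-- Collapsing `x` and `y` amounts to collapsing nothing, the edges of one color, or everything. -/
def HasColor (x y : Glued p₀ p₁) : Prop :=
  x = y ∨ (∃ p, ∀ α : LatticeCon (Glued p₀ p₁), α.r x y ↔ Collapses α p) ∨
    ∀ α : LatticeCon (Glued p₀ p₁), α.r x y ↔ Collapses α p₀ ∧ Collapses α p₁

theorem HasColor.of_flip {x y : Glued p₀ p₁}
    (h : HasColor y.flip x.flip) : HasColor x y := by
  have hd : ∀ α : LatticeCon (Glued p₀ p₁), (dual α).r y.flip x.flip ↔ α.r x y := by
    intro α
    change α.r y.flip.flip x.flip.flip ↔ _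
    rw [flip_flip, flip_flip]
    exact ⟨fun h => α.symm h, fun h => α.symm h⟩
  rcases h with h | ⟨p, h⟩ | h
  · exact Or.inl (by rw [← flip_flip x, ← h, flip_flip])
  · exact Or.inr (Or.inl ⟨p, fun α => by rw [← hd, h, collapses_dual]⟩)
  · refine Or.inr (Or.inr fun α => ?_)
    rw [← hd, h, collapses_dual, collapses_dual, and_comm]

theorem hasColor_lo_lo (h01 : ¬ p₀ ≤ p₁) (h10 : ¬ p₁ ≤ p₀) {x y : Half {p : P // p < p₀}}
    (hxy : x ≤ y) : HasColor (lo x : Glued p₀ p₁) (lo y) := by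
  rcases hxy.eq_or_lt with rfl | hxy
  · exact Or.inl rfl
  refine Or.inr (Or.inl ?_)
  rcases lo_lo_color (p₁ := p₁) hxy with h | ⟨p, h⟩
  · exact ⟨p₀, fun α => by rw [h, collapses_left α h01]⟩
  · exact ⟨p, fun α => by rw [h, collapses_of_lt_left α h10 p.2]⟩

theorem collapses_both_iff (α : LatticeCon (Glued p₀ p₁)) (h01 : ¬ p₀ ≤ p₁) (h10 : ¬ p₁ ≤ p₀) :
    Collapses α p₀ ∧ Collapses α p₁ ↔ ∀ x y, α.r x y := by
  rw [collapses_left α h01, collapses_right α h10]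
  refine ⟨fun h x y => ?_, fun h => ⟨h _ _, h _ _⟩⟩
  exact α.r_inf_sup_iff.1 (α.rel_of_le (α.trans h.1 h.2) bot_le inf_le_sup le_top)

theorem hasColor_lo_mid (h01 : ¬ p₀ ≤ p₁) (h10 : ¬ p₁ ≤ p₀) {x : Half {p : P // p < p₀}}
    {p h₀ h₁ t} (hx : x ≤ side ⟨p, h₀⟩ t.lower) :
    HasColor (lo x : Glued p₀ p₁) (mid p h₀ h₁ t) := by
  have hle : (lo x : Glued p₀ p₁) ≤ mid p h₀ h₁ t := hx
  have up_of : ∀ α : LatticeCon (Glued p₀ p₁), α.r (lo x) (mid p h₀ h₁ t) →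
      α.r ctr (up bot) := by
    intro α h
    refine (rel_ctr_up_iff α (side ⟨p, h₁⟩ t.upper)).1 (α.rel_up h (by simp) (by simp) ?_)
    rintro (_ | _ | _ | w) hw hw'
    exacts [absurd hw id, absurd hw' id, absurd hw id, hw']
  by_cases hxp : ∃ k, x = side ⟨p, h₀⟩ k
  · obtain ⟨k, rfl⟩ := hxp
    refine Or.inr (Or.inl ⟨p₁, fun α => ?_⟩)
    rw [collapses_right α h10]
    refine ⟨up_of α, fun h => ?_⟩
    have h1 : α.r (lo (side ⟨p, h₀⟩ t.lower)) (mid p h₀ h₁ t) := by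
      refine α.rel_down h le_top (by simp) fun w hw hw' => ?_
      rcases w with w | _ | _ | _
      exacts [hw, absurd hw id, absurd hw' id, absurd hw id]
    have h2 : LowerEdge α ⟨p, h₀⟩ := by
      rw [lowerEdge_iff_upperEdge α h₀ h₁]
      exact α.rel_of_le h (by simp) (by simp) (by simp)
    exact α.trans (α.rel_of_le h2 (by simp) hx (by simp)) h1
  · refine Or.inr (Or.inr fun α => ⟨fun h => ?_, fun h => ?_⟩)
    · rw [collapses_left α h01, collapses_right α h10]
      exact ⟨(rel_side_iff α hx (by simpa using hxp)).1
        (α.rel_of_le h le_rfl hx (by simp)), up_of α h⟩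
    · exact (collapses_both_iff α h01 h10).1 h _ _

theorem hasColor_mid_mid (h01 : ¬ p₀ ≤ p₁) (h10 : ¬ p₁ ≤ p₀) {p : P} (h₀ : p < p₀)
    (h₁ : p < p₁) {t s : Diamond} (hts : t ≤ s) :
    HasColor (mid p h₀ h₁ t) (mid p h₀ h₁ s) := by
  rcases hts.eq_or_lt with rfl | hlt
  · exact Or.inl rfl
  refine Or.inr (Or.inl ⟨p, fun α => ⟨fun h => ?_, fun h => ?_⟩⟩)
  · have key : ∀ {t s : Diamond}, t ≤ s → t ≠ s →
        (t.lower = false ∧ s.lower = true) ∨ (t.upper = true ∧ s.upper = false) := by decide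
    rcases key hts hlt.ne with ⟨ht, hs⟩ | ⟨ht, hs⟩
    · exact (collapses_of_lt_left α h10 h₀).2 (lowerEdge_of_mid α h₀ h₁ ht hs h)
    · exact (collapses_of_lt_right α h01 h₁).2 (upperEdge_of_mid α h₀ h₁ ht hs h)
  · exact α.rel_of_le (mid_of_lowerEdge α h₀ h₁ (h.2.2.1 h₀)) (by simp [Diamond.z_le])
      ⟨rfl, hts⟩ (by simp [Diamond.le_u])

/-- Every interval is collapsed together with the edges of one color or of all colors. -/
theorem hasColor_of_le (h01 : ¬ p₀ ≤ p₁) (h10 : ¬ p₁ ≤ p₀) {x y : Glued p₀ p₁} (hxy : x ≤ y) :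
    HasColor x y := by
  rcases x with x | _ | ⟨p, hp, hp', t⟩ | x <;> rcases y with y | _ | ⟨q, hq, hq', s⟩ | y
  case lo.lo => exact hasColor_lo_lo h01 h10 hxy
  case lo.ctr =>
    exact Or.inr (Or.inl ⟨p₀, fun α => by rw [rel_ctr_iff, collapses_left α h01]⟩)
  case lo.mid => exact hasColor_lo_mid h01 h10 hxy
  case lo.up =>
    refine Or.inr (Or.inr fun α => ⟨fun h => ?_, fun h => ?_⟩)
    · rw [collapses_left α h01, collapses_right α h10, ← rel_ctr_iff α x, ← rel_ctr_up_iff α y]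
      exact ⟨α.rel_of_le h le_rfl (by simp) (by simp), α.rel_of_le h (by simp) (by simp) le_rfl⟩
    · exact (collapses_both_iff α h01 h10).1 h _ _
  case ctr.ctr => exact Or.inl rfl
  case ctr.up =>
    exact Or.inr (Or.inl ⟨p₁, fun α => by rw [rel_ctr_up_iff, collapses_right α h10]⟩)
  case mid.mid =>
    obtain ⟨rfl, hts⟩ := hxy
    exact hasColor_mid_mid h01 h10 hp hp' hts
  case mid.up =>
    refine HasColor.of_flip (hasColor_lo_mid h10 h01 ?_)
    rw [Diamond.lower_flip]
    exact hxy
  case up.up => exact HasColor.of_flip (hasColor_lo_lo h10 h01 hxy)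
  all_goals exact absurd hxy id

theorem top_rel (x y : Glued p₀ p₁) : (⊤ : LatticeCon (Glued p₀ p₁)).r x y :=
  con_le_iff.1 le_top

/-- The colors collapsed by a congruence can be any lower set. -/
theorem exists_collapses_iff (hle : ∀ q : P, q ≤ p₀ ∨ q ≤ p₁) (h01 : ¬ p₀ ≤ p₁) (h10 : ¬ p₁ ≤ p₀)
    (E : LowerSet P) : ∃ α : LatticeCon (Glued p₀ p₁), ∀ p, Collapses α p ↔ p ∈ E := by
  have key : ∀ {p₀ p₁ : P}, (∀ q : P, q ≤ p₀ ∨ q ≤ p₁) → ¬ p₀ ≤ p₁ → ¬ p₁ ≤ p₀ → p₀ ∉ E →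
      ∃ α : LatticeCon (Glued p₀ p₁), ∀ p, Collapses α p ↔ p ∈ E := by
    classical
    intro p₀ p₁ hle h01 h10 h0
    have hE : ∀ p q, p < q → decide (q ∈ E) = true → decide (p ∈ E) = true := by
      simpa using fun p q h hq => E.lower h.le hq
    by_cases h1 : p₁ ∈ E
    · refine ⟨upperCon (fun p => p ∈ E) hE (by simpa using fun p h => E.lower h.le h1), fun p => ?_⟩
      rcases hle p with h | h <;> rcases h.eq_or_lt with rfl | h
      · rw [collapses_left _ h01]
        change loTop _ bot = up bot ↔ _
        simp [loTop, h0]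
      · rw [collapses_of_lt_left _ h10 h, LowerEdge]
        change loTop _ (side _ false) = loTop _ (side _ true) ↔ _
        by_cases hp : p < p₁
        · simpa [loTop, hp] using E.lower hp.le h1
        · simp [loTop, hp, top]
      · rw [collapses_right _ h10]
        exact iff_of_true rfl h1
      · rw [collapses_of_lt_right _ h01 h, UpperEdge]
        exact iff_of_true rfl (E.lower h.le h1)
    · refine ⟨sideCon (fun p => p ∈ E) hE, fun p => ?_⟩
      rcases hle p with h | h <;> rcases h.eq_or_lt with rfl | h
      · rw [collapses_left _ h01]
        change lo _ = ctr ↔ _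
        simp [h0]
      · rw [collapses_of_lt_left _ h10 h, LowerEdge]
        change lo (top _ _) = lo (top _ _) ↔ _
        simp [top]
      · rw [collapses_right _ h10]
        change ctr = up _ ↔ _
        simp [h1]
      · rw [collapses_of_lt_right _ h01 h, UpperEdge]
        change up (bottom _ _) = up (bottom _ _) ↔ _
        simp [bottom]
  by_cases h0 : p₀ ∈ E
  · by_cases h1 : p₁ ∈ E
    · refine ⟨⊤, fun p => iff_of_true ?_ ((hle p).elim (E.lower · h0) (E.lower · h1))⟩
      exact ⟨fun _ => top_rel _ _, fun _ => top_rel _ _, fun _ => top_rel _ _, fun _ => top_rel _ _⟩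
    · obtain ⟨α, hα⟩ := key (fun q => (hle q).symm) h10 h01 h1
      exact ⟨dual α, fun p => by rw [collapses_dual, hα]⟩
  · exact key hle h01 h10 h0

theorem le_iff_collapses (h01 : ¬ p₀ ≤ p₁) (h10 : ¬ p₁ ≤ p₀) {α β : LatticeCon (Glued p₀ p₁)} :
    α ≤ β ↔ ∀ p, Collapses α p → Collapses β p := by
  refine ⟨fun h p => Collapses.mono h, fun h x y hxy => ?_⟩
  rw [← r_inf_sup_iff] at hxy ⊢
  rcases hasColor_of_le h01 h10 (inf_le_sup : x ⊓ y ≤ x ⊔ y) with he | ⟨p, hp⟩ | hp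
  · rw [he]
  · exact (hp β).2 (h p ((hp α).1 hxy))
  · exact (hp β).2 (((hp α).1 hxy).imp (h _) (h _))

/-- Congruences correspond to the lower sets of `P` by the colors that they collapse. -/
noncomputable def conIso (hle : ∀ q : P, q ≤ p₀ ∨ q ≤ p₁) (h01 : ¬ p₀ ≤ p₁) (h10 : ¬ p₁ ≤ p₀) :
    LatticeCon (Glued p₀ p₁) ≃o LowerSet P :=
  RelIso.ofSurjective
    (OrderEmbedding.ofMapLEIff
      (fun α => ⟨{p | Collapses α p}, fun q _ hpq hq => hq.of_le h01 h10 (hle q) hpq⟩)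
      fun _ _ => (le_iff_collapses h01 h10).symm)
    fun E => by
      obtain ⟨α, hα⟩ := exists_collapses_iff hle h01 h10 E
      exact ⟨α, LowerSet.ext (Set.ext hα)⟩

section conIso

variable (hle : ∀ q : P, q ≤ p₀ ∨ q ≤ p₁) (h01 : ¬ p₀ ≤ p₁) (h10 : ¬ p₁ ≤ p₀)

theorem mem_conIso {α : LatticeCon (Glued p₀ p₁)} {p : P} :
    p ∈ conIso hle h01 h10 α ↔ Collapses α p := Iff.rfl

/-- The congruence of color `p`. -/
noncomputable def colorCon (p : P) : LatticeCon (Glued p₀ p₁) :=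
  (conIso hle h01 h10).symm (LowerSet.Iic p)

theorem colorCon_le_iff {α : LatticeCon (Glued p₀ p₁)} {p : P} :
    colorCon hle h01 h10 p ≤ α ↔ Collapses α p := by
  rw [colorCon, OrderIso.symm_apply_le, LowerSet.Iic_le, mem_conIso]

theorem con_eq_colorCon {x y : Glued p₀ p₁} {p : P} (h : ∀ α, α.r x y ↔ Collapses α p) :
    con x y = colorCon hle h01 h10 p :=
  eq_of_forall_ge_iff fun α => by rw [con_le_iff, h, colorCon_le_iff]

theorem supIrred_iff_colorCon {α : LatticeCon (Glued p₀ p₁)} :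
    SupIrred α ↔ ∃ p, colorCon hle h01 h10 p = α := by
  simp only [← supIrred_apply_iff (conIso hle h01 h10), LowerSet.supIrred_iff_of_finite, colorCon,
    OrderIso.symm_apply_eq]

/-- The order isomorphism of `P` onto the join-irreducible congruences. -/
noncomputable def jiIso : P ≃o Ji (LatticeCon (Glued p₀ p₁)) :=
  RelIso.ofSurjective
    (OrderEmbedding.ofMapLEIff
      (fun p => ⟨colorCon hle h01 h10 p, (supIrred_iff_colorCon hle h01 h10).2 ⟨p, rfl⟩⟩)
      fun p q => by
        rw [Subtype.mk_le_mk, colorCon, colorCon, OrderIso.le_iff_le, LowerSet.Iic_le,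
          LowerSet.mem_Iic_iff])
    fun α => by
      obtain ⟨p, hp⟩ := (supIrred_iff_colorCon hle h01 h10).1 α.2
      exact ⟨p, Subtype.ext hp⟩

theorem jiIso_apply (p : P) : (jiIso hle h01 h10 p).1 = colorCon hle h01 h10 p := rfl

include hle h01 h10 in
theorem supIrred_of_mem_princ {α : LatticeCon (Glued p₀ p₁)} (hα : α ∈ Princ (Glued p₀ p₁))
    (h0 : α ≠ ⊥) (h1 : α ≠ ⊤) : SupIrred α := by
  obtain ⟨x, y, rfl⟩ := hα
  have hxy : ∀ β : LatticeCon (Glued p₀ p₁), β.r x y ↔ β.r (x ⊓ y) (x ⊔ y) :=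
    fun β => β.r_inf_sup_iff.symm
  rcases hasColor_of_le h01 h10 (inf_le_sup : x ⊓ y ≤ x ⊔ y) with he | ⟨p, hp⟩ | hp
  · exact absurd (le_bot_iff.1 (con_le_iff.2 ((hxy ⊥).2 (he ▸ (⊥ : LatticeCon _).refl _)))) h0
  · exact (supIrred_iff_colorCon hle h01 h10).2
      ⟨p, (con_eq_colorCon hle h01 h10 fun β => by rw [hxy, hp]).symm⟩
  · refine absurd (top_le_iff.1 fun a b _ => ?_) h1
    exact (collapses_both_iff _ h01 h10).1 ((hp _).1 ((hxy _).1 (con_rel x y))) a b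

end conIso

end Glued

/-! ### The edges at the centre -/

namespace Glued

open Half LatticeCon

variable {P : Type u} [PartialOrder P] [Finite P] {p₀ p₁ : P}

omit [Finite P] in
theorem lt_ctr {x : Glued p₀ p₁} (h : x < ctr) : ∃ y, x = lo y := by
  rcases x with x | _ | _ | _
  · exact ⟨x, rfl⟩
  · exact absurd h (lt_irrefl _)
  all_goals exact absurd h.le id

omit [Finite P] in
theorem ctr_lt {x : Glued p₀ p₁} (h : ctr < x) : ∃ y, x = up y := by
  rcases x with _ | _ | _ | y
  case up => exact ⟨y, rfl⟩
  case ctr => exact absurd h (lt_irrefl _)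
  all_goals exact absurd h.le id

omit [Finite P] in
theorem flip_lt_flip {x y : Glued p₀ p₁} : x.flip < y.flip ↔ y < x :=
  (OrderDual.toDual_lt_toDual (a := y.flip) (b := x.flip)).symm.trans (swap p₀ p₁).lt_iff_lt

omit [Finite P] in
theorem flip_covBy_flip {x y : Glued p₀ p₁} : x.flip ⋖ y.flip ↔ y ⋖ x :=
  toDual_covBy_toDual_iff.symm.trans (apply_covBy_apply_iff (swap p₀ p₁))

theorem supIrred_of_flip {x : Glued p₀ p₁} (h : InfIrred x.flip) : SupIrred x := by
  have h' : SupIrred (OrderDual.toDual x.flip) := supIrred_toDual.2 h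
  exact (supIrred_apply_iff (swap p₀ p₁)).1 h'

omit [Finite P] in
theorem side_covBy_side (p : {p : P // p < p₀}) :
    (lo (side p false) : Glued p₀ p₁) ⋖ lo (side p true) := by
  refine ⟨lt_of_le_of_ne (by simp) (by simp), fun w hw hw' => ?_⟩
  rcases side_le_iff.1 hw.le with rfl | ⟨-, rfl⟩ | h | ⟨_, t, rfl, -⟩
  exacts [hw'.ne rfl, hw.ne rfl, absurd (h.trans hw'.le) id, absurd hw'.le id]

omit [Finite P] in
theorem side_covBy_ctr (p : {p : P // p < p₀}) : (lo (side p true) : Glued p₀ p₁) ⋖ ctr := by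
  refine ⟨lt_of_le_of_ne (by simp) (by simp), fun w hw hw' => ?_⟩
  rcases side_le_iff.1 hw.le with rfl | ⟨h, -⟩ | h | ⟨_, t, rfl, -⟩
  exacts [hw.ne rfl, absurd h (by simp), hw'.not_ge h, absurd hw'.le id]

/-- Without a diamond over `p` the elements above the lower edge of color `p` form a chain up
to `ctr`. -/
theorem infIrred_side {p : {p : P // p < p₀}} (hp : ¬ p.1 ≤ p₁) (k : Bool) :
    InfIrred (lo (side p k) : Glued p₀ p₁) := by
  have hmid : ∀ h : p.1 < p₁, False := fun h => hp h.le
  refine ⟨fun h => ?_, fun {x y} hxy => ?_⟩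
  · exact absurd (h (b := ctr) (by simp)) id
  · have hx : lo (side p k) ≤ x := hxy ▸ inf_le_left
    have hy : lo (side p k) ≤ y := hxy ▸ inf_le_right
    by_contra! hne
    have above : ∀ {z : Glued p₀ p₁}, lo (side p k) ≤ z → z ≠ lo (side p k) →
        (k = false ∧ lo (side p true) ≤ z) ∨ ctr ≤ z := by
      intro z hz hzk
      rcases side_le_iff.1 hz with rfl | ⟨rfl, rfl⟩ | h | ⟨h, -⟩
      · rcases k with _ | _
        exacts [Or.inl ⟨rfl, le_rfl⟩, absurd rfl hzk]
      · exact absurd rfl hzk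
      · exact Or.inr h
      · exact (hmid h).elim
    rcases k with _ | _
    · have key : ∀ {z : Glued p₀ p₁}, lo (side p false) ≤ z → z ≠ lo (side p false) →
          lo (side p true) ≤ z := fun hz hzk =>
        (above hz hzk).elim (·.2) fun h => (side_covBy_ctr p).le.trans h
      have := le_inf (key hx hne.1) (key hy hne.2)
      rw [hxy] at this
      simp at this
    · have key : ∀ {z : Glued p₀ p₁}, lo (side p true) ≤ z → z ≠ lo (side p true) → ctr ≤ z :=
        fun hz hzk => (above hz hzk).elim (fun h => absurd h.1 (by simp)) id
      have := le_inf (key hx hne.1) (key hy hne.2)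
      rw [hxy] at this
      exact this

theorem rel_flip (α : LatticeCon (Glued p₀ p₁)) (x y : Glued p₀ p₁) :
    (dual α).r x.flip y.flip ↔ α.r x y := by
  change α.r x.flip.flip y.flip.flip ↔ _
  rw [flip_flip, flip_flip]

theorem rel_below_side_iff (α : LatticeCon (Glued p₀ p₁)) (h01 : ¬ p₀ ≤ p₁)
    {p : {p : P // p < p₀}} {x : Glued p₀ p₁} (hne : x ≠ lo (side p false))
    (hx : x < lo (side p true)) : α.r x (lo (side p true)) ↔ Collapses α p₀ := by
  obtain ⟨y, rfl⟩ := lt_ctr (hx.trans (side_covBy_ctr p).lt)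
  rw [collapses_left α h01]
  refine rel_side_iff α hx.le ?_
  rintro (_ | _) rfl
  exacts [hne rfl, hx.ne rfl]

end Glued

open Glued Half LatticeCon in
theorem theoremT {P : Type u} [PartialOrder P] [Finite P] (p₀ p₁ : P) (hne : p₀ ≠ p₁)
    (hmax : ∀ p : P, IsMax p ↔ p = p₀ ∨ p = p₁) :
    ∃ (L : Type u) (_ : Lattice L) (_ : BoundedOrder L) (_ : Finite L) (i : L)
      (ζ : P ≃o Ji (LatticeCon L)) (a b a' b' : P → L),
      i ≠ ⊥ ∧ i ≠ ⊤ ∧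
      (∀ α ∈ Princ L, α ≠ ⊥ → α ≠ ⊤ → SupIrred α) ∧
      (∀ x : L, x < i → LatticeCon.con x i = (ζ p₀).1) ∧
      (∀ x : L, i < x → LatticeCon.con x i = (ζ p₁).1) ∧
      (∀ p : P, p < p₀ → a p ⋖ b p ∧ b p ⋖ i ∧ LatticeCon.con (a p) (b p) = (ζ p).1) ∧
      (∀ p : P, p < p₁ → i ⋖ b' p ∧ b' p ⋖ a' p ∧ LatticeCon.con (a' p) (b' p) = (ζ p).1) ∧
      (∀ p : P, ¬ p ≤ p₁ → p ≠ p₀ → InfIrred (a p) ∧ InfIrred (b p)) ∧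
      (∀ p : P, ¬ p ≤ p₀ → p ≠ p₁ → SupIrred (a' p) ∧ SupIrred (b' p)) ∧
      (∀ p : P, p < p₀ → ∀ x : L, x ≠ a p → x < b p → LatticeCon.con x (b p) = (ζ p₀).1) ∧
      (∀ p : P, p < p₁ → ∀ x : L, x ≠ a' p → b' p < x → LatticeCon.con x (b' p) = (ζ p₁).1) := by
  classical
  have hle : ∀ q : P, q ≤ p₀ ∨ q ≤ p₁ := by
    intro q
    obtain ⟨m, hqm, hm⟩ := Finite.exists_le_maximal (p := fun _ : P => True) (a := q) trivial
    rcases (hmax m).1 fun x hx => hm.2 trivial hx with rfl | rfl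
    exacts [Or.inl hqm, Or.inr hqm]
  have h01 : ¬ p₀ ≤ p₁ := fun h => hne (((hmax p₀).2 (Or.inl rfl)).eq_of_le h)
  have h10 : ¬ p₁ ≤ p₀ := fun h => hne (((hmax p₁).2 (Or.inr rfl)).eq_of_le h).symm
  refine ⟨Glued p₀ p₁, inferInstance, inferInstance, inferInstance, ctr, jiIso hle h01 h10,
    fun p => if h : p < p₀ then lo (side ⟨p, h⟩ false) else ctr,
    fun p => if h : p < p₀ then lo (side ⟨p, h⟩ true) else ctr,
    fun p => if h : p < p₁ then up (side ⟨p, h⟩ false) else ctr,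
    fun p => if h : p < p₁ then up (side ⟨p, h⟩ true) else ctr,
    by simp [Glued.bot_def], by simp [Glued.top_def],
    fun α => supIrred_of_mem_princ hle h01 h10, ?_, ?_, ?_, ?_, ?_, ?_, ?_, ?_⟩
  all_goals simp only [jiIso_apply]
  · intro x hx
    obtain ⟨y, rfl⟩ := lt_ctr hx
    exact con_eq_colorCon _ _ _ fun α => by rw [rel_ctr_iff, collapses_left α h01]
  · intro x hx
    obtain ⟨y, rfl⟩ := ctr_lt hx
    refine con_eq_colorCon _ _ _ fun α => ?_
    rw [collapses_right α h10, ← rel_ctr_up_iff α y]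
    exact ⟨fun h => α.symm h, fun h => α.symm h⟩
  · intro p hp
    simp only [hp, dif_pos]
    exact ⟨side_covBy_side _, side_covBy_ctr _,
      con_eq_colorCon _ _ _ fun α => (collapses_of_lt_left α h10 hp).symm⟩
  · intro p hp
    simp only [hp, dif_pos]
    refine ⟨flip_covBy_flip.1 (side_covBy_ctr _), flip_covBy_flip.1 (side_covBy_side _),
      con_eq_colorCon _ _ _ fun α => ?_⟩
    rw [collapses_of_lt_right α h01 hp]
    exact ⟨fun h => α.symm h, fun h => α.symm h⟩
  · intro p hp hp0
    have hp' : p < p₀ := lt_of_le_of_ne ((hle p).resolve_right hp) hp0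
    simp only [hp', dif_pos]
    exact ⟨infIrred_side hp false, infIrred_side hp true⟩
  · intro p hp hp0
    have hp' : p < p₁ := lt_of_le_of_ne ((hle p).resolve_left hp) hp0
    simp only [hp', dif_pos]
    exact ⟨supIrred_of_flip (infIrred_side hp false), supIrred_of_flip (infIrred_side hp true)⟩
  · intro p hp
    simp only [hp, dif_pos]
    exact fun x hne hx => con_eq_colorCon _ _ _ fun α => rel_below_side_iff α h01 hne hx
  · intro p hp
    simp only [hp, dif_pos]
    intro x hne hx
    refine con_eq_colorCon _ _ _ fun α => ?_
    rw [← rel_flip, ← collapses_dual α]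
    refine rel_below_side_iff (dual α) h10 (fun h => hne ?_) (flip_lt_flip.2 hx)
    rw [← flip_flip x, h]
    rfl
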